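/- For a simple graph $G$ of order $n$, let $\lambda_1(G)\ge\lambda_2(G)\ge\cdots\ge\lambda_n(G)$ be the eigenvalues of its adjacency matrix, counted with multiplicity. For every integer $k\ge 1$ put \[ c_k=\sup\left\{\frac{\lambda_k(G)}{n} : G \text{ is a graph of order } n\ge k\right\},\qquad c_{-k}=\sup\left\{\frac{|\lambda_{n-k+1}(G)|}{n} : G \text{ is a graph of order } n\ge k\right\}. \] **Theorem.** If $5\le k\le 15$, then \[ c_k\ge\frac{1}{k-1/2}\qquad\text{and}\qquad c_{-k+1}\ge\frac{1}{k-1/2}, \] where $c_{-k+1}=c_{-(k-1)}$. If $k\ge 16$, then \[ c_k\ge\frac{1}{4\sqrt{k-1}}\qquad\text{and}\qquad c_{-k+1}\ge\frac{1}{4\sqrt{k-1}}. \] In particular, the bound $\lambda_k(G)\le\lfloor n/k\rfloor$ claimed by Powers for all connected graphs $G$ of order $n$ fails for every $k\ge 5$ and all sufficiently large $n$: for every $k\ge5$ there is an $n_0$ such that for every $n\ge n_0$ with $n\ge k$ there is a connected graph $G$ of order $n$ with $\lambda_k(G)>\lfloor n/k\rfloor$. -/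

import Mathlib

open Classical in
/-- The real `0`-`1` adjacency matrix of a graph is Hermitian. -/
theorem adjMatrix_isHermitian {n : ℕ} (G : SimpleGraph (Fin n)) :
    (G.adjMatrix ℝ).IsHermitian := by
  rw [Matrix.IsHermitian, Matrix.conjTranspose_eq_transpose_of_trivial]
  exact G.isSymm_adjMatrix

open Classical in
/-- `graphEigenvalue G k` is the `k`-th largest eigenvalue `λ_k(G)` of the adjacency matrix of a
graph `G` of order `n`, counted with multiplicity, for `1 ≤ k ≤ n` (and `0` for other `k`).
Mathlib's `eigenvalues₀` lists the eigenvalues in nonincreasing order with indices from `0`. -/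
noncomputable def graphEigenvalue {n : ℕ} (G : SimpleGraph (Fin n)) (k : ℕ) : ℝ :=
  if h : 1 ≤ k ∧ k ≤ n then
    (adjMatrix_isHermitian G).eigenvalues₀ ⟨k - 1, by rw [Fintype.card_fin]; omega⟩
  else 0

/-- `c_k = sup {λ_k(G) / n : G is a graph of order n ≥ k}`, for `k ≥ 1`. -/
noncomputable def cPos (k : ℕ) : ℝ :=
  sSup {x : ℝ | ∃ n : ℕ, k ≤ n ∧ ∃ G : SimpleGraph (Fin n), x = graphEigenvalue G k / n}

/-- `c_{-k} = sup {|λ_{n-k+1}(G)| / n : G is a graph of order n ≥ k}`, for `k ≥ 1`. -/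
noncomputable def cNeg (k : ℕ) : ℝ :=
  sSup {x : ℝ | ∃ n : ℕ, k ≤ n ∧ ∃ G : SimpleGraph (Fin n),
    x = |graphEigenvalue G (n - k + 1)| / n}

/-! Everything reduces to one finite object: a symmetric relation, loops allowed, on `d` points,
whose quadratic form is at least `c * d` times the squared norm on a space of dimension at least `k`
(`HasFormRatio`). Blowing up each point and adding a few dominating vertices yields connected graphs
of every large order `n` with `λ_k ≥ c n - C` (`HasFormRatio.exists_graph`). In the complement,
vectors of zero sum see the negated form; this costs one dimension and makes the last `k - 1`
eigenvalues at most `-(c n - C)`. Letting `n` grow gives `c_k ≥ c` and `c_{-k+1} ≥ c`, and `c > 1/k`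
refutes the floor bound.

Three relations supply `c`: the 3 × 3 rook graph with loops for `k = 5`, triangular graphs with
loops for `k ≥ 6`, and the `+1` entries of a Sylvester matrix for the square-root bound. -/

open scoped Matrix

/-! ### Quadratic forms and min-max bounds for eigenvalues -/

open Classical in
/-- The quadratic form of the `0`-`1` matrix of a relation. -/
noncomputable def relForm {V : Type*} [Fintype V] (r : V → V → Prop) (x : V → ℝ) : ℝ :=
  ∑ i, ∑ j, if r i j then x i * x j else 0

/-- The eigenvalues listed by `graphEigenvalue` diagonalize the adjacency form in suitable
orthonormal coordinates. -/
theorem exists_coords_graphEigenvalue {n : ℕ} (G : SimpleGraph (Fin n)) :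
    ∃ (v : Fin n → (Fin n → ℝ) →ₗ[ℝ] ℝ) (l : Fin n → ℝ), Antitone l ∧
      (∀ i : Fin n, l i = graphEigenvalue G (i + 1)) ∧
      (∀ i, ∃ x, ∀ j, v j x = if j = i then 1 else 0) ∧
      (∀ x, ∑ i, x i ^ 2 = ∑ i, v i x ^ 2) ∧
      ∀ x, relForm G.Adj x = ∑ i, l i * v i x ^ 2 := by
  classical
  have hA : (G.adjMatrix ℝ).IsHermitian := by
    convert adjMatrix_isHermitian G
  set e : Fin (Fintype.card (Fin n)) ≃ Fin n := Fintype.equivOfCardEq (Fintype.card_fin _) with he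
  set c : Fin n ≃ Fin (Fintype.card (Fin n)) := finCongr (Fintype.card_fin n).symm with hc
  set b := hA.eigenvectorBasis.reindex (c.trans e).symm with hb
  have hbi : ∀ i, b i = hA.eigenvectorBasis (e (c i)) := fun i => by simp [hb]
  have hl : ∀ i, hA.eigenvalues (e (c i)) = hA.eigenvalues₀ (c i) := fun i => by
    simp [Matrix.IsHermitian.eigenvalues, he]
  have hAb : ∀ i, G.adjMatrix ℝ *ᵥ ⇑(b i) = hA.eigenvalues₀ (c i) • ⇑(b i) := fun i => by
    rw [hbi, hA.mulVec_eigenvectorBasis, hl]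
  have hin : ∀ x y : EuclideanSpace ℝ (Fin n), inner ℝ x y = ⇑x ⬝ᵥ ⇑y := fun x y => by
    rw [EuclideanSpace.inner_eq_star_dotProduct, dotProduct_comm]; simp
  refine ⟨fun i => (innerₛₗ ℝ (b i)) ∘ₗ (WithLp.linearEquiv 2 ℝ (Fin n → ℝ)).symm.toLinearMap,
    fun i => hA.eigenvalues₀ (c i), ?_, ?_, ?_, ?_, ?_⟩
  · intro i j hij
    exact hA.eigenvalues₀_antitone (by simpa [hc] using hij)
  · intro i
    have : 1 ≤ (i : ℕ) + 1 ∧ (i : ℕ) + 1 ≤ n := ⟨by omega, i.2⟩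
    rw [graphEigenvalue, dif_pos this]
    congr!
  · intro i
    refine ⟨⇑(b i), fun j => ?_⟩
    have := orthonormal_iff_ite.1 b.orthonormal j i
    simpa using! this
  · intro x
    have := b.sum_sq_norm_inner_right (WithLp.toLp 2 x)
    simp only [Real.norm_eq_abs, sq_abs, EuclideanSpace.norm_sq_eq] at this
    simpa using! this.symm
  · intro x
    have h1 := b.sum_inner_mul_inner (WithLp.toLp 2 x) (WithLp.toLp 2 (G.adjMatrix ℝ *ᵥ x))
    have h2 : inner ℝ (WithLp.toLp 2 x) (WithLp.toLp 2 (G.adjMatrix ℝ *ᵥ x)) =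
        relForm G.Adj x := by
      rw [hin]
      simp only [relForm, dotProduct, Matrix.mulVec, Finset.mul_sum]
      refine Finset.sum_congr rfl fun i _ => Finset.sum_congr rfl fun j _ => ?_
      by_cases h : G.Adj i j <;> simp [h]
    rw [← h2, ← h1]
    refine Finset.sum_congr rfl fun i _ => ?_
    have h3 : inner ℝ (b i) (WithLp.toLp 2 (G.adjMatrix ℝ *ᵥ x)) =
        hA.eigenvalues₀ (c i) * inner ℝ (b i) (WithLp.toLp 2 x) := by
      rw [hin, hin]
      change _ ⬝ᵥ (G.adjMatrix ℝ *ᵥ x) = _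
      rw [Matrix.dotProduct_mulVec, ← Matrix.mulVec_transpose, SimpleGraph.transpose_adjMatrix,
        hAb, smul_dotProduct, smul_eq_mul]
    rw [h3, real_inner_comm]
    simp
    ring

/-- A vector in the range of an injective map that is annihilated by few functionals. -/
theorem exists_ne_zero_of_card_lt {E V ι : Type*} [AddCommGroup E] [Module ℝ E]
    [FiniteDimensional ℝ E] [Fintype ι] (T : E →ₗ[ℝ] V → ℝ) (v : ι → (V → ℝ) →ₗ[ℝ] ℝ)
    (h : Fintype.card ι < Module.finrank ℝ E) : ∃ y, y ≠ 0 ∧ ∀ i, v i (T y) = 0 := by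
  have := LinearMap.ker_ne_bot_of_finrank_lt (f := LinearMap.pi fun i => v i ∘ₗ T) (by simpa using h)
  obtain ⟨y, hy, hy0⟩ := Submodule.exists_mem_ne_zero_of_ne_bot this
  exact ⟨y, hy0, fun i => congrFun (LinearMap.mem_ker.1 hy) i⟩

theorem sum_sq_pos_of_injective {E V : Type*} [AddCommGroup E] [Module ℝ E] [Fintype V]
    {T : E →ₗ[ℝ] V → ℝ} (hT : Function.Injective T) {y : E} (hy : y ≠ 0) :
    0 < ∑ i, T y i ^ 2 := by
  have : T y ≠ 0 := fun h => hy (hT (by simpa using h))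
  obtain ⟨i, hi⟩ := Function.ne_iff.1 this
  exact Finset.sum_pos' (fun _ _ => sq_nonneg _) ⟨i, Finset.mem_univ _, by
    have : T y i ≠ 0 := hi
    positivity⟩

theorem le_graphEigenvalue_of_le_relForm {n k : ℕ} {G : SimpleGraph (Fin n)} {E : Type*}
    [AddCommGroup E] [Module ℝ E] [FiniteDimensional ℝ E] (hk : 1 ≤ k) (hkn : k ≤ n)
    (hE : k ≤ Module.finrank ℝ E) {T : E →ₗ[ℝ] Fin n → ℝ} (hT : Function.Injective T) {μ : ℝ}
    (h : ∀ y, μ * ∑ i, T y i ^ 2 ≤ relForm G.Adj (T y)) : μ ≤ graphEigenvalue G k := by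
  obtain ⟨v, l, hl, hlG, -, hv, hform⟩ := exists_coords_graphEigenvalue G
  -- Courant–Fischer: `k - 1` conditions leave a nonzero vector orthogonal to the first `k - 1`
  -- eigenvectors.
  obtain ⟨y, hy, hy0⟩ := exists_ne_zero_of_card_lt T
    (fun i : Fin (k - 1) => v ⟨i, by omega⟩) (by simp; omega)
  have hlk : l ⟨k - 1, by omega⟩ = graphEigenvalue G k := by
    rw [hlG]; congr 1; simp; omega
  have h1 : relForm G.Adj (T y) ≤ graphEigenvalue G k * ∑ i, T y i ^ 2 := by
    rw [hform, hv, Finset.mul_sum]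
    refine Finset.sum_le_sum fun i _ => ?_
    by_cases hi : (i : ℕ) < k - 1
    · have : v i (T y) = 0 := hy0 ⟨i, hi⟩
      simp [this]
    · rw [← hlk]
      exact mul_le_mul_of_nonneg_right (hl (by rw [Fin.le_def]; simp; omega)) (sq_nonneg _)
  exact le_of_mul_le_mul_right ((h y).trans h1) (sum_sq_pos_of_injective hT hy)

/-- The two adjacency matrices sum to `J - I`, and the form of `J` is the square of the coordinate
sum. -/
theorem relForm_compl_of_sum_eq_zero {V : Type*} [Fintype V] (G : SimpleGraph V) {x : V → ℝ}
    (hx : ∑ i, x i = 0) : relForm Gᶜ.Adj x = -relForm G.Adj x - ∑ i, x i ^ 2 := by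
  classical
  have h : ∑ i, ∑ j, x i * x j = 0 := by rw [← Finset.sum_mul_sum, hx, zero_mul]
  have h2 : ∑ i, x i ^ 2 = ∑ i, ∑ j, if i = j then x i * x j else 0 := by simp [sq]
  have : relForm Gᶜ.Adj x + relForm G.Adj x + ∑ i, x i ^ 2 = ∑ i, ∑ j, x i * x j := by
    rw [h2]
    simp only [relForm, ← Finset.sum_add_distrib]
    refine Finset.sum_congr rfl fun i _ => Finset.sum_congr rfl fun j _ => ?_
    by_cases hij : i = j
    · subst hij; simp
    · by_cases hG : G.Adj i j <;> simp [hij, hG]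
  linarith

theorem graphEigenvalue_compl_le_of_le_relForm {n k : ℕ} {G : SimpleGraph (Fin n)} {E : Type*}
    [AddCommGroup E] [Module ℝ E] [FiniteDimensional ℝ E] (hk : 2 ≤ k) (hkn : k ≤ n)
    (hE : k ≤ Module.finrank ℝ E) {T : E →ₗ[ℝ] Fin n → ℝ} (hT : Function.Injective T) {μ : ℝ}
    (h : ∀ y, μ * ∑ i, T y i ^ 2 ≤ relForm G.Adj (T y)) :
    graphEigenvalue Gᶜ (n - (k - 1) + 1) ≤ -μ := by
  obtain ⟨v, l, hl, hlG, -, hv, hform⟩ := exists_coords_graphEigenvalue Gᶜ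
  -- `none` imposes zero sum; the other `k - 2` conditions kill the last eigenvectors. That is still
  -- only `k - 1` conditions.
  obtain ⟨y, hy, hy0⟩ := exists_ne_zero_of_card_lt T
    (fun i : Option (Fin (k - 2)) => i.elim (∑ j, LinearMap.proj j)
      fun i => v ⟨n - (k - 2) + i, by omega⟩) (by simp; omega)
  have hs : ∑ i, T y i = 0 := by simpa using hy0 none
  have hlk : l ⟨n - (k - 1), by omega⟩ = graphEigenvalue Gᶜ (n - (k - 1) + 1) := hlG _
  have h1 : graphEigenvalue Gᶜ (n - (k - 1) + 1) * ∑ i, T y i ^ 2 ≤ relForm Gᶜ.Adj (T y) := by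
    rw [hform, hv, Finset.mul_sum]
    refine Finset.sum_le_sum fun i _ => ?_
    by_cases hi : n - (k - 2) ≤ (i : ℕ)
    · have h2 := hy0 (some ⟨i - (n - (k - 2)), by omega⟩)
      have h3 : (⟨n - (k - 2) + (i - (n - (k - 2))), by omega⟩ : Fin n) = i := by
        ext; simp; omega
      simp only [Option.elim_some, h3] at h2
      simp [h2]
    · rw [← hlk]
      exact mul_le_mul_of_nonneg_right (hl (by rw [Fin.le_def]; simp; omega)) (sq_nonneg _)
  rw [relForm_compl_of_sum_eq_zero G hs] at h1
  have hpos := sum_sq_pos_of_injective hT hy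
  refine le_of_mul_le_mul_right ?_ hpos
  linarith [h y]

theorem abs_relForm_le {V : Type*} [Fintype V] (r : V → V → Prop) (x : V → ℝ) :
    |relForm r x| ≤ Fintype.card V * ∑ i, x i ^ 2 := by
  classical
  calc |relForm r x| ≤ ∑ i, ∑ j, |x i| * |x j| := by
        refine (Finset.abs_sum_le_sum_abs _ _).trans (Finset.sum_le_sum fun i _ => ?_)
        refine (Finset.abs_sum_le_sum_abs _ _).trans (Finset.sum_le_sum fun j _ => ?_)
        split_ifs
        · rw [abs_mul]
        · rw [abs_zero]; positivity
    _ = (∑ i, |x i|) ^ 2 := by rw [← Finset.sum_mul_sum, sq]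
    _ ≤ _ := by
      have := sq_sum_le_card_mul_sum_sq (s := Finset.univ) (f := fun i => |x i|)
      simpa using this

/-- This bounds the sets defining `cPos` and `cNeg`; the real `sSup` of a set unbounded above would
be the default `0`. -/
theorem abs_graphEigenvalue_div_le_one {n : ℕ} (G : SimpleGraph (Fin n)) (k : ℕ) :
    |graphEigenvalue G k| / n ≤ 1 := by
  refine div_le_one_of_le₀ ?_ (Nat.cast_nonneg _)
  by_cases hk : 1 ≤ k ∧ k ≤ n
  · obtain ⟨v, l, -, hlG, hb, hv, hform⟩ := exists_coords_graphEigenvalue G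
    obtain ⟨x, hx⟩ := hb ⟨k - 1, by omega⟩
    have h := abs_relForm_le G.Adj x
    rw [hform, hv] at h
    simp only [hx, hlG] at h
    simpa [Nat.sub_add_cancel hk.1] using h
  · simp [graphEigenvalue, hk]

theorem graphEigenvalue_div_le_cPos {n k : ℕ} (hkn : k ≤ n) (G : SimpleGraph (Fin n)) :
    graphEigenvalue G k / n ≤ cPos k := by
  refine le_csSup ⟨1, ?_⟩ ⟨n, hkn, G, rfl⟩
  rintro _ ⟨m, -, H, rfl⟩
  exact (div_le_div_of_nonneg_right (le_abs_self _) (Nat.cast_nonneg _)).trans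
    (abs_graphEigenvalue_div_le_one H k)

theorem abs_graphEigenvalue_div_le_cNeg {n k : ℕ} (hkn : k ≤ n) (G : SimpleGraph (Fin n)) :
    |graphEigenvalue G (n - k + 1)| / n ≤ cNeg k := by
  refine le_csSup ⟨1, ?_⟩ ⟨n, hkn, G, rfl⟩
  rintro _ ⟨m, -, H, rfl⟩
  exact abs_graphEigenvalue_div_le_one H _

/-! ### Blow-ups with dominating vertices -/

/-- Replace each vertex of a relation by `t` copies, delete the loops, and add a set `R` of
vertices that are adjacent to everything. -/
def blowupCone {ι : Type*} (r : ι → ι → Prop) (hr : ∀ i j, r i j → r j i) (t : ℕ) (R : Type*) :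
    SimpleGraph ((ι × Fin t) ⊕ R) where
  Adj p q := p ≠ q ∧ ∀ a b, p = Sum.inl a → q = Sum.inl b → r a.1 b.1
  symm := ⟨fun _ _ h => ⟨h.1.symm, fun a b ha hb => hr _ _ (h.2 b a hb ha)⟩⟩
  loopless := ⟨fun _ h => h.1 rfl⟩

theorem blowupCone_adj_inl_inl {ι : Type*} (r : ι → ι → Prop) (hr : ∀ i j, r i j → r j i)
    (t : ℕ) (R : Type*) (a b : ι × Fin t) :
    (blowupCone r hr t R).Adj (Sum.inl a) (Sum.inl b) ↔ a ≠ b ∧ r a.1 b.1 :=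
  ⟨fun h => ⟨fun hab => h.1 (by rw [hab]), h.2 a b rfl rfl⟩,
    fun h => ⟨fun hab => h.1 (Sum.inl_injective hab), fun a' b' ha hb => by
      rw [← Sum.inl_injective ha, ← Sum.inl_injective hb]; exact h.2⟩⟩

theorem blowupCone_connected {ι : Type*} (r : ι → ι → Prop) (hr : ∀ i j, r i j → r j i) (t : ℕ)
    (R : Type*) [Nonempty R] : (blowupCone r hr t R).Connected := by
  obtain ⟨o⟩ := ‹Nonempty R›
  have h : ∀ p, (blowupCone r hr t R).Reachable (Sum.inr o) p := fun p => by
    by_cases hp : Sum.inr o = p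
    · rw [hp]
    · exact SimpleGraph.Adj.reachable ⟨hp, fun a b ha => by simp at ha⟩
  have : Nonempty ((ι × Fin t) ⊕ R) := ⟨Sum.inr o⟩
  exact ⟨fun p q => (h p).symm.trans (h q)⟩

/-- Extend a function to the blow-up, constant on copies and zero on the added vertices. -/
def blowupExtend (ι : Type*) (t : ℕ) (R : Type*) :
    (ι → ℝ) →ₗ[ℝ] ((ι × Fin t) ⊕ R → ℝ) where
  toFun x := Sum.elim (fun a => x a.1) 0
  map_add' x y := by ext (a | b) <;> simp
  map_smul' s x := by ext (a | b) <;> simp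

theorem sum_sq_blowupExtend {ι : Type*} [Fintype ι] (t : ℕ) (R : Type*) [Fintype R]
    (x : ι → ℝ) : ∑ p, blowupExtend ι t R x p ^ 2 = t * ∑ i, x i ^ 2 := by
  simp [blowupExtend, Fintype.sum_prod_type, Finset.mul_sum]

/-- The full blow-up scales the form by `t ^ 2`; deleting its loops loses at most the squared norm
of the extended vector. -/
theorem relForm_blowupExtend {ι : Type*} [Fintype ι] (r : ι → ι → Prop)
    (hr : ∀ i j, r i j → r j i) (t : ℕ) (R : Type*) [Fintype R] (x : ι → ℝ) :
    t ^ 2 * relForm r x - t * ∑ i, x i ^ 2 ≤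
      relForm (blowupCone r hr t R).Adj (blowupExtend ι t R x) := by
  classical
  have h1 : relForm (blowupCone r hr t R).Adj (blowupExtend ι t R x) =
      ∑ a : ι × Fin t, ∑ b : ι × Fin t, if a ≠ b ∧ r a.1 b.1 then x a.1 * x b.1 else 0 := by
    simp [relForm, blowupExtend, blowupCone_adj_inl_inl]
  have h2 : (t : ℝ) ^ 2 * relForm r x =
      ∑ a : ι × Fin t, ∑ b : ι × Fin t, if r a.1 b.1 then x a.1 * x b.1 else 0 := by
    simp only [relForm, Fintype.sum_prod_type, Finset.sum_const, Finset.card_univ,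
      Fintype.card_fin, nsmul_eq_mul, Finset.mul_sum]
    refine Finset.sum_congr rfl fun i _ => Finset.sum_congr rfl fun j _ => ?_
    ring
  have h3 : (t : ℝ) * ∑ i, x i ^ 2 =
      ∑ a : ι × Fin t, ∑ b : ι × Fin t, if a = b then x a.1 * x b.1 else 0 := by
    simp [Fintype.sum_prod_type, Finset.mul_sum, sq]
  rw [h1, h2, h3, ← Finset.sum_sub_distrib]
  refine Finset.sum_le_sum fun a _ => ?_
  rw [← Finset.sum_sub_distrib]
  refine Finset.sum_le_sum fun b _ => ?_
  by_cases hab : a = b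
  · subst hab
    by_cases h : r a.1 a.1 <;> simp [h, mul_self_nonneg]
  · simp [hab]

/-! ### From a finite relation to asymptotic bounds -/

/-- Some `0`-`1` symmetric matrix has a `k`-dimensional space of vectors on which its quadratic
form is at least `c` times its order times the squared norm. -/
def HasFormRatio (k : ℕ) (c : ℝ) : Prop :=
  ∃ (ι : Type) (_ : Fintype ι) (r : ι → ι → Prop) (W : Submodule ℝ (ι → ℝ)),
    (∀ i j, r i j → r j i) ∧ k ≤ Module.finrank ℝ W ∧
      ∀ x ∈ W, c * Fintype.card ι * ∑ i, x i ^ 2 ≤ relForm r x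

theorem HasFormRatio.mono {k : ℕ} {c d : ℝ} (h : HasFormRatio k c) (hd : d ≤ c) :
    HasFormRatio k d := by
  obtain ⟨ι, _, r, W, hr, hk, hW⟩ := h
  refine ⟨ι, _, r, W, hr, hk, fun x hx => le_trans ?_ (hW x hx)⟩
  have : 0 ≤ ∑ i, x i ^ 2 := Finset.sum_nonneg fun _ _ => sq_nonneg _
  gcongr

theorem HasFormRatio.exists_graph {k : ℕ} {c : ℝ} (h : HasFormRatio k c) (hk : 2 ≤ k)
    (hc : 0 ≤ c) : ∃ C : ℝ, ∃ m : ℕ, k ≤ m ∧ ∀ n, m < n → ∃ G : SimpleGraph (Fin n),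
      G.Connected ∧ c * n - C ≤ graphEigenvalue G k ∧
        graphEigenvalue Gᶜ (n - (k - 1) + 1) ≤ -(c * n - C) := by
  obtain ⟨ι, _, r, W, hr, hkW, hW⟩ := h
  have hkι : k ≤ Fintype.card ι := hkW.trans ((Submodule.finrank_le W).trans (by simp))
  set d := Fintype.card ι with hd
  -- `c * d` pays for the at most `d` vertices outside the blow-up, `1` for the deleted loops.
  refine ⟨c * d + 1, d, hkι, fun n hn => ?_⟩
  -- Using `n - 1` rather than `n` leaves at least one dominating vertex, hence connectedness.
  set t := (n - 1) / d with ht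
  have ht1 : 1 ≤ t := (Nat.one_le_div_iff (by omega)).2 (by omega)
  have htn : d * t ≤ n - 1 := Nat.mul_div_le _ _
  have htn' : n ≤ d * t + d := by
    have := Nat.lt_mul_div_succ (n - 1) (show 0 < d by omega)
    rw [← ht, Nat.mul_add_one] at this
    omega
  have : Nonempty (Fin (n - d * t)) := ⟨⟨0, by omega⟩⟩
  let e : Fin n ≃ (ι × Fin t) ⊕ Fin (n - d * t) := Fintype.equivOfCardEq (by
    simp [← hd]; omega)
  set H := blowupCone r hr t (Fin (n - d * t)) with hH
  set G : SimpleGraph (Fin n) := H.comap e with hG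
  let T : W →ₗ[ℝ] Fin n → ℝ :=
    LinearMap.funLeft ℝ ℝ e ∘ₗ blowupExtend ι t (Fin (n - d * t)) ∘ₗ W.subtype
  have hTi : ∀ x i, T x i = blowupExtend ι t (Fin (n - d * t)) x (e i) := fun x i => rfl
  have hT : Function.Injective T := by
    intro x y hxy
    ext i
    have := congrFun hxy (e.symm (Sum.inl (i, ⟨0, by omega⟩)))
    simpa [hTi, blowupExtend] using this
  have hsum : ∀ x, ∑ i, T x i ^ 2 = t * ∑ i, (x : ι → ℝ) i ^ 2 := fun x => by
    rw [← sum_sq_blowupExtend t (Fin (n - d * t)), ← e.sum_comp]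
    rfl
  have hform : ∀ x, relForm G.Adj (T x) =
      relForm H.Adj (blowupExtend ι t (Fin (n - d * t)) x) := fun x => by
    unfold relForm
    rw [← e.sum_comp]
    refine Finset.sum_congr rfl fun i _ => ?_
    rw [← e.sum_comp]
    rfl
  have hmain : ∀ x, (c * n - (c * d + 1)) * ∑ i, T x i ^ 2 ≤ relForm G.Adj (T x) := fun x => by
    rw [hform, hsum]
    refine le_trans ?_ (relForm_blowupExtend r hr t _ _)
    have h1 := hW x x.2
    have h0 : 0 ≤ ∑ i, (x : ι → ℝ) i ^ 2 := Finset.sum_nonneg fun _ _ => sq_nonneg _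
    have h2 : (n : ℝ) ≤ d * t + d := by exact_mod_cast htn'
    have h3 : c * n ≤ c * (d * t + d) := mul_le_mul_of_nonneg_left h2 hc
    calc (c * n - (c * d + 1)) * (t * ∑ i, (x : ι → ℝ) i ^ 2)
        ≤ (c * d * t - 1) * (t * ∑ i, (x : ι → ℝ) i ^ 2) :=
          mul_le_mul_of_nonneg_right (by linarith) (by positivity)
      _ = t ^ 2 * (c * d * ∑ i, (x : ι → ℝ) i ^ 2) - t * ∑ i, (x : ι → ℝ) i ^ 2 := by ring
      _ ≤ _ := by gcongr
  refine ⟨G, ?_, le_graphEigenvalue_of_le_relForm (by omega) (by omega) hkW hT hmain,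
    graphEigenvalue_compl_le_of_le_relForm hk (by omega) hkW hT hmain⟩
  exact (SimpleGraph.Iso.connected_iff (SimpleGraph.Iso.comap e H)).2
    (blowupCone_connected r hr t _)

theorem le_of_forall_sub_div_le {c C a : ℝ} {m : ℕ}
    (h : ∀ n : ℕ, m < n → (c * n - C) / n ≤ a) : c ≤ a := by
  have h1 : Filter.Tendsto (fun n : ℕ => c - C / n) Filter.atTop (nhds (c - 0)) :=
    tendsto_const_nhds.sub (tendsto_const_div_atTop_nhds_zero_nat C)
  rw [sub_zero] at h1
  refine le_of_tendsto h1 ?_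
  filter_upwards [Filter.eventually_gt_atTop m] with n hn
  have : (n : ℝ) ≠ 0 := by
    have : n ≠ 0 := by omega
    exact_mod_cast this
  have := h n hn
  rwa [sub_div, mul_div_assoc, div_self ‹_›, mul_one] at this

theorem HasFormRatio.le_cPos {k : ℕ} {c : ℝ} (h : HasFormRatio k c) (hk : 2 ≤ k) (hc : 0 ≤ c) :
    c ≤ cPos k := by
  obtain ⟨C, m, hm, h⟩ := h.exists_graph hk hc
  refine le_of_forall_sub_div_le (C := C) (m := m) fun n hn => ?_
  obtain ⟨G, -, hG, -⟩ := h n hn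
  exact (div_le_div_of_nonneg_right hG (Nat.cast_nonneg _)).trans
    (graphEigenvalue_div_le_cPos (by omega) G)

theorem HasFormRatio.le_cNeg {k : ℕ} {c : ℝ} (h : HasFormRatio k c) (hk : 2 ≤ k) (hc : 0 ≤ c) :
    c ≤ cNeg (k - 1) := by
  obtain ⟨C, m, hm, h⟩ := h.exists_graph hk hc
  refine le_of_forall_sub_div_le (C := C) (m := m) fun n hn => ?_
  obtain ⟨G, -, -, hG⟩ := h n hn
  exact (div_le_div_of_nonneg_right ((le_neg_of_le_neg hG).trans (neg_le_abs _))
    (Nat.cast_nonneg _)).trans (abs_graphEigenvalue_div_le_cNeg (by omega) Gᶜ)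

theorem HasFormRatio.exists_connected_floor_lt {k : ℕ} {c : ℝ} (h : HasFormRatio k c)
    (hk : 2 ≤ k) (hc : 1 / (k : ℝ) < c) : ∃ n₀ : ℕ, ∀ n : ℕ, n₀ ≤ n → k ≤ n →
      ∃ G : SimpleGraph (Fin n), G.Connected ∧
        (⌊(n : ℝ) / (k : ℝ)⌋ : ℝ) < graphEigenvalue G k := by
  have hc0 : 0 ≤ c := le_trans (by positivity) hc.le
  obtain ⟨C, m, hm, h⟩ := h.exists_graph hk hc0
  obtain ⟨N, hN⟩ := exists_nat_gt (C / (c - 1 / k))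
  refine ⟨max (m + 1) N, fun n hn _ => ?_⟩
  obtain ⟨G, hGc, hG, -⟩ := h n (by omega)
  refine ⟨G, hGc, lt_of_le_of_lt (Int.floor_le _) (lt_of_lt_of_le ?_ hG)⟩
  have hNn : (N : ℝ) ≤ n := by exact_mod_cast (le_max_right _ _).trans hn
  rw [div_lt_iff₀ (by linarith)] at hN
  have : (N : ℝ) * (c - 1 / k) ≤ n * (c - 1 / k) :=
    mul_le_mul_of_nonneg_right hNn (by linarith)
  have h2 : (n : ℝ) / k = n * (1 / k) := by ring
  rw [h2]
  linarith

/-! ### Rook and triangular graphs -/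

/-- The 3 × 3 rook graph with loops has eigenvalue 5 once and 2 four times; these eigenspaces
together consist of the functions `a i + b j`, normalized here by `b 2 = 0`. -/
theorem hasFormRatio_five : HasFormRatio 5 (2 / 9) := by
  classical
  let T : (Fin 5 → ℝ) →ₗ[ℝ] (Fin 3 × Fin 3 → ℝ) :=
    { toFun := fun y p => ![y 0, y 1, y 2] p.1 + ![y 3, y 4, 0] p.2
      map_add' := fun x y => by
        ext ⟨i, j⟩; fin_cases i <;> fin_cases j <;> simp <;> ring
      map_smul' := fun s y => by
        ext ⟨i, j⟩; fin_cases i <;> fin_cases j <;> simp <;> ring }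
  have hTi : ∀ y i j, T y (i, j) = ![y 0, y 1, y 2] i + ![y 3, y 4, 0] j := fun _ _ _ => rfl
  have hT : Function.Injective T := by
    rw [injective_iff_map_eq_zero]
    intro y hy
    have h := fun i j => congrFun hy (i, j)
    simp only [hTi, Pi.zero_apply] at h
    have h1 := h 0 2
    have h2 := h 1 2
    have h3 := h 2 2
    have h4 := h 0 0
    have h5 := h 0 1
    simp at h1 h2 h3 h4 h5
    ext i
    fin_cases i <;> simp <;> linarith
  refine ⟨Fin 3 × Fin 3, inferInstance, fun p q => p.1 = q.1 ∨ p.2 = q.2, LinearMap.range T,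
    fun p q h => h.imp Eq.symm Eq.symm, ?_, ?_⟩
  · rw [LinearMap.finrank_range_of_inj hT]; simp
  · rintro _ ⟨y, rfl⟩
    simp only [relForm, Fintype.sum_prod_type, Fin.sum_univ_three, hTi]
    simp
    -- The two sides differ by exactly three times this square.
    nlinarith [sq_nonneg (y 0 + y 1 + y 2 + y 3 + y 4)]

theorem sum_succAbove_eq {m : ℕ} (f : Fin (m + 1) → Fin (m + 1) → ℝ) :
    ∑ p : Fin (m + 1) × Fin m, f p.1 (p.1.succAbove p.2) =
      ∑ i, ∑ j, if i = j then 0 else f i j := by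
  rw [Fintype.sum_prod_type]
  refine Finset.sum_congr rfl fun i _ => ?_
  rw [Fin.sum_univ_succAbove _ i]
  simp [Fin.ne_succAbove]

/-- The triangular graph, on ordered pairs `(i, i.succAbove a)` of distinct elements. -/
theorem hasFormRatio_triangular {m : ℕ} (hm : 2 ≤ m) :
    HasFormRatio (m + 1) (2 * (m - 2) / (m * (m + 1))) := by
  classical
  have hm0 : (2 : ℝ) ≤ m := by exact_mod_cast hm
  let X (y : Fin (m + 1) → ℝ) (i j : Fin (m + 1)) : ℝ := if i = j then 0 else y i + y j
  have hXd : ∀ y i, X y i i = 0 := fun y i => if_pos rfl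
  have hXo : ∀ y i j, i ≠ j → X y i j = y i + y j := fun y i j h => if_neg h
  have hXs : ∀ y i j, X y i j = X y j i := fun y i j => by
    by_cases h : i = j
    · rw [h]
    · rw [hXo y i j h, hXo y j i (Ne.symm h), add_comm]
  have hrow : ∀ y i, ∑ j, X y i j = (m - 1) * y i + ∑ j, y j := fun y i => by
    have h : ∀ j, X y i j = y i + y j - if i = j then 2 * y i else 0 := fun j => by
      by_cases h : i = j
      · subst h; simp [hXd]; ring
      · simp [hXo y i j h, h]
    simp only [h, Finset.sum_sub_distrib, Finset.sum_add_distrib]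
    simp
    ring
  have htot : ∀ y, ∑ i, ∑ j, X y i j = 2 * m * ∑ j, y j := fun y => by
    simp only [hrow, Finset.sum_add_distrib, ← Finset.mul_sum]
    simp
    ring
  let T : (Fin (m + 1) → ℝ) →ₗ[ℝ] (Fin (m + 1) × Fin m → ℝ) :=
    { toFun := fun y p => X y p.1 (p.1.succAbove p.2)
      map_add' := fun x y => by
        ext p; simp only [hXo _ _ _ (Fin.ne_succAbove _ _), Pi.add_apply]; ring
      map_smul' := fun s y => by
        ext p
        simp only [hXo _ _ _ (Fin.ne_succAbove _ _), Pi.smul_apply, smul_eq_mul,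
          RingHom.id_apply]
        ring }
  have hTi : ∀ y p, T y p = X y p.1 (p.1.succAbove p.2) := fun _ _ => rfl
  have hT : Function.Injective T := by
    rw [injective_iff_map_eq_zero]
    intro y hy
    have hX : ∀ i j, X y i j = 0 := fun i j => by
      by_cases h : i = j
      · rw [h, hXd]
      · obtain ⟨a, rfl⟩ := Fin.exists_succAbove_eq (Ne.symm h)
        exact congrFun hy (i, a)
    have hs := htot y
    simp only [hX, Finset.sum_const_zero] at hs
    have hs0 : ∑ j, y j = 0 := by
      rcases mul_eq_zero.1 hs.symm with h | h
      · linarith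
      · exact h
    ext i
    have hr := hrow y i
    simp only [hX, Finset.sum_const_zero, hs0, add_zero] at hr
    rcases mul_eq_zero.1 hr.symm with h | h
    · linarith
    · exact h
  let r (i j k l : Fin (m + 1)) : Prop := (i = k ∨ i = l) ∨ (j = k ∨ j = l)
  refine ⟨Fin (m + 1) × Fin m, inferInstance,
    fun p q => r p.1 (p.1.succAbove p.2) q.1 (q.1.succAbove q.2), LinearMap.range T,
    fun p q h => ?_, ?_, ?_⟩
  · simp only [r] at h ⊢
    tauto
  · rw [LinearMap.finrank_range_of_inj hT]; simp
  rintro _ ⟨y, rfl⟩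
  have hr : ∀ i j, i ≠ j → ∑ k, ∑ l, (if r i j k l then X y k l else 0) =
      2 * (m - 2) * X y i j + 4 * ∑ k, y k := fun i j hij => by
    -- Inclusion–exclusion over the four coincidences: only `(i, j)` and `(j, i)` are counted twice,
    -- since `X` vanishes on the diagonal.
    have h : ∀ k l, (if r i j k l then X y k l else 0) =
        (if i = k then X y k l else 0) + (if i = l then X y k l else 0) +
        (if j = k then X y k l else 0) + (if j = l then X y k l else 0) -
        (if i = k then if j = l then X y k l else 0 else 0) -
        (if j = k then if i = l then X y k l else 0 else 0) := fun k l => by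
      by_cases hkl : k = l
      · subst hkl; simp [hXd]
      · by_cases h1 : i = k
        · subst h1
          by_cases h4 : j = l
          · subst h4; simp [r, hij, hij.symm]
          · simp [r, hij.symm, h4, hkl]
        · by_cases h2 : i = l
          · subst h2
            by_cases h3 : j = k
            · subst h3; simp [r, hij, hij.symm]
            · simp [r, h1, h3, hij.symm]
          · by_cases h3 : j = k
            · subst h3; simp [r, h2, hij, hkl]
            · simp [r, h1, h2, h3]
    have hcol : ∀ i, ∑ k, X y k i = (m - 1) * y i + ∑ j, y j := fun i => by
      rw [← hrow]; exact Finset.sum_congr rfl fun k _ => hXs y k i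
    have hsw : ∀ i, ∑ k, ∑ l, (if i = k then X y k l else 0) = ∑ l, X y i l := fun i => by
      rw [Finset.sum_comm]; simp
    have hsw2 : ∀ i j, ∑ k, ∑ l, (if i = k then if j = l then X y k l else 0 else 0) =
        X y i j := fun i j => by
      rw [Finset.sum_comm]; simp
    simp only [h, Finset.sum_sub_distrib, Finset.sum_add_distrib, hsw, hsw2]
    simp only [Finset.sum_ite_eq, Finset.mem_univ, if_true, hcol, hrow]
    rw [hXs y j i, hXo y i j hij]
    ring
  have hform : relForm (fun p q : Fin (m + 1) × Fin m =>
      r p.1 (p.1.succAbove p.2) q.1 (q.1.succAbove q.2)) (T y) =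
      2 * (m - 2) * ∑ p, T y p ^ 2 + 8 * m * (∑ k, y k) ^ 2 := by
    have h1 : ∀ p : Fin (m + 1) × Fin m, ∑ q : Fin (m + 1) × Fin m,
        (if r p.1 (p.1.succAbove p.2) q.1 (q.1.succAbove q.2) then T y p * T y q else 0) =
        2 * (m - 2) * T y p ^ 2 + 4 * (∑ k, y k) * T y p := fun p => by
      have h2 := sum_succAbove_eq fun k l =>
        if r p.1 (p.1.succAbove p.2) k l then X y k l else 0
      have h3 : ∀ k l, (if k = l then 0 else
          if r p.1 (p.1.succAbove p.2) k l then X y k l else 0) =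
          if r p.1 (p.1.succAbove p.2) k l then X y k l else 0 := fun k l => by
        by_cases hkl : k = l
        · subst hkl; simp [hXd]
        · simp [hkl]
      simp only [h3] at h2
      rw [hr _ _ (Fin.ne_succAbove _ _)] at h2
      simp only [← mul_ite_zero, ← Finset.mul_sum]
      simp only [hTi, h2]
      ring
    have h4 : ∑ p, T y p = 2 * m * ∑ k, y k := by
      rw [← htot]
      refine (sum_succAbove_eq (X y)).trans
        (Finset.sum_congr rfl fun i _ => Finset.sum_congr rfl fun j _ => ?_)
      by_cases h : i = j
      · rw [if_pos h, h, hXd]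
      · rw [if_neg h]
    calc _ = ∑ p, (2 * (m - 2) * T y p ^ 2 + 4 * (∑ k, y k) * T y p) :=
          Finset.sum_congr rfl fun p _ => by convert h1 p
      _ = _ := by
        rw [Finset.sum_add_distrib, ← Finset.mul_sum, ← Finset.mul_sum, h4]
        ring
  rw [hform]
  have h5 : 2 * ((m : ℝ) - 2) / (m * (m + 1)) * Fintype.card (Fin (m + 1) × Fin m) =
      2 * (m - 2) := by
    simp only [Fintype.card_prod, Fintype.card_fin]
    push_cast
    field_simp
  rw [h5]
  have : 0 ≤ 8 * (m : ℝ) * (∑ k, y k) ^ 2 := by positivity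
  linarith

/-! ### Sylvester matrices -/

/-- The Sylvester matrix of order `2 ^ j`. -/
def sylvester (j : ℕ) : Matrix (Fin j → Bool) (Fin j → Bool) ℝ :=
  Matrix.of fun a b => ∏ i, if a i && b i then -1 else 1

theorem sylvester_symm {j : ℕ} (a b : Fin j → Bool) : sylvester j a b = sylvester j b a := by
  simp [sylvester, and_comm]

theorem sylvester_eq_one_or {j : ℕ} (a b : Fin j → Bool) :
    sylvester j a b = 1 ∨ sylvester j a b = -1 := by
  simp only [sylvester, Matrix.of_apply]
  refine Finset.prod_induction _ (fun x : ℝ => x = 1 ∨ x = -1) ?_ (Or.inl rfl) fun i _ => ?_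
  · rintro _ _ (rfl | rfl) (rfl | rfl) <;> simp
  · split_ifs <;> simp

/-- As a tensor power, the matrix has entries of its square that factor over coordinates. -/
theorem sylvester_mul_self (j : ℕ) : sylvester j * sylvester j = (2 : ℝ) ^ j • 1 := by
  ext a c
  have h : (sylvester j * sylvester j) a c = ∏ i, ∑ b : Bool,
      (if a i && b then (-1 : ℝ) else 1) * (if b && c i then -1 else 1) := by
    rw [Fintype.prod_sum]
    simp only [Matrix.mul_apply, sylvester, Matrix.of_apply, Finset.prod_mul_distrib]
  have h2 : ∀ i, ∑ b : Bool, (if a i && b then (-1 : ℝ) else 1) * (if b && c i then -1 else 1) =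
      if a i = c i then 2 else 0 := fun i => by
    cases a i <;> cases c i <;> norm_num
  rw [h]
  simp only [h2]
  by_cases hac : a = c
  · subst hac; simp
  · obtain ⟨i, hi⟩ := Function.ne_iff.1 hac
    rw [Finset.prod_eq_zero (Finset.mem_univ i) (if_neg hi)]
    simp [hac]

theorem sylvester_trace {j : ℕ} (hj : j ≠ 0) : (sylvester j).trace = 0 := by
  have h : (sylvester j).trace = ∏ _i : Fin j, ∑ b : Bool, if b && b then (-1 : ℝ) else 1 := by
    rw [Fintype.prod_sum]
    rfl
  rw [h]
  simp [hj]

/-- `S / s` is a traceless involution, so `P` projects onto the `s`-eigenspace of `S`, of half the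
full dimension. The relation has matrix `(J + S) / 2`, and `J` contributes a nonnegative square. -/
theorem hasFormRatio_sylvester (j : ℕ) :
    HasFormRatio (2 ^ j) (1 / (2 * √(2 ^ (j + 1)))) := by
  classical
  set s : ℝ := √(2 ^ (j + 1)) with hs
  have hs2 : s * s = 2 ^ (j + 1) := Real.mul_self_sqrt (by positivity)
  have hs0 : 0 < s := by positivity
  set S := sylvester (j + 1) with hS
  set P : Matrix (Fin (j + 1) → Bool) (Fin (j + 1) → Bool) ℝ := (1 / 2 : ℝ) • (1 + s⁻¹ • S) with hP
  have hPP : P * P = P := by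
    have h1 : (s⁻¹ • S) * (s⁻¹ • S) = 1 := by
      rw [Matrix.smul_mul, Matrix.mul_smul, hS, sylvester_mul_self, ← hs2, smul_smul, smul_smul,
        show s⁻¹ * s⁻¹ * (s * s) = 1 by field_simp, one_smul]
    rw [hP, Matrix.smul_mul, Matrix.mul_smul, mul_add, add_mul, add_mul, h1, smul_smul]
    simp only [one_mul, mul_one]
    module
  have hSS : S * S = (2 : ℝ) ^ (j + 1) • 1 := sylvester_mul_self _
  have hSP : S * P = s • P := by
    rw [hP, Matrix.mul_smul, mul_add, Matrix.mul_smul, hSS, ← hs2, smul_smul,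
      show s⁻¹ * (s * s) = s by field_simp, mul_one, smul_comm s, smul_add s, smul_smul,
      mul_inv_cancel₀ hs0.ne', one_smul, add_comm S]
  have htr : P.trace = 2 ^ j := by
    rw [hP, Matrix.trace_smul, Matrix.trace_add, Matrix.trace_smul, hS,
      sylvester_trace (Nat.succ_ne_zero j), Matrix.trace_one]
    simp [pow_succ]
    ring
  have hidem : IsIdempotentElem (Matrix.toLin' P) := by
    rw [IsIdempotentElem, Module.End.mul_eq_comp, ← Matrix.toLin'_mul, hPP]
  refine ⟨Fin (j + 1) → Bool, inferInstance, fun a b => S a b = 1,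
    LinearMap.range (Matrix.toLin' P), fun a b h => (sylvester_symm b a).trans h, ?_, ?_⟩
  · have h1 := (LinearMap.IsIdempotentElem.isProj_range _ hidem).trace
    rw [Matrix.trace_toLin'_eq, htr] at h1
    exact_mod_cast h1.le
  · rintro _ ⟨y, rfl⟩
    set x := Matrix.toLin' P y with hx
    have hSx : S *ᵥ x = s • x := by
      rw [hx, Matrix.toLin'_apply, Matrix.mulVec_mulVec, hSP, Matrix.smul_mulVec]
    have h1 : relForm (fun a b => S a b = 1) x =
        1 / 2 * (∑ a, x a) ^ 2 + 1 / 2 * (s * ∑ a, x a ^ 2) := by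
      have h2 : s * ∑ a, x a ^ 2 = ∑ a, ∑ b, x a * (S a b * x b) := by
        simp only [← Finset.mul_sum]
        rw [Finset.mul_sum]
        refine Finset.sum_congr rfl fun a _ => ?_
        have : ∑ b, S a b * x b = s * x a := congrFun hSx a
        rw [this]
        ring
      rw [h2, sq, Finset.sum_mul_sum, Finset.mul_sum, Finset.mul_sum, ← Finset.sum_add_distrib]
      refine Finset.sum_congr rfl fun a _ => ?_
      rw [Finset.mul_sum, Finset.mul_sum, ← Finset.sum_add_distrib]
      refine Finset.sum_congr rfl fun b _ => ?_
      rcases sylvester_eq_one_or a b with h | h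
      · rw [if_pos h, hS, h]; ring
      · rw [if_neg (by change ¬ sylvester (j + 1) a b = 1; rw [h]; norm_num), hS, h]; ring
    have h3 : 1 / (2 * s) * Fintype.card (Fin (j + 1) → Bool) = 1 / 2 * s := by
      have : (Fintype.card (Fin (j + 1) → Bool) : ℝ) = s * s := by rw [hs2]; simp
      rw [this]
      field_simp
    rw [h1, h3]
    have := sq_nonneg (∑ a, x a)
    linarith

/-! ### Choice of relation for each `k` -/

theorem HasFormRatio.anti {k l : ℕ} {c : ℝ} (h : HasFormRatio l c) (hkl : k ≤ l) :
    HasFormRatio k c := by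
  obtain ⟨ι, _, r, W, hr, hk, hW⟩ := h
  exact ⟨ι, _, r, W, hr, hkl.trans hk, hW⟩

theorem hasFormRatio_sqrt {k : ℕ} (hk : 2 ≤ k) :
    HasFormRatio k (1 / (4 * √((k : ℝ) - 1))) := by
  -- With `2 ^ j ≤ k - 1 < 2 ^ (j + 1)`, the space of dimension `2 ^ (j + 1)` suffices and its ratio
  -- is `1 / (4 * √(2 ^ j))`.
  obtain ⟨j, hj⟩ : ∃ j, j = Nat.log 2 (k - 1) := ⟨_, rfl⟩
  have h1 : 2 ^ j ≤ k - 1 := hj ▸ Nat.pow_log_le_self 2 (by omega)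
  have h2 : k - 1 < 2 ^ (j + 1) := hj ▸ Nat.lt_pow_succ_log_self one_lt_two _
  have h3 : (2 : ℝ) ^ j ≤ k - 1 := by
    have : ((2 ^ j : ℕ) : ℝ) ≤ (k - 1 : ℕ) := by exact_mod_cast h1
    rw [Nat.cast_sub (by omega)] at this
    exact_mod_cast this
  refine ((hasFormRatio_sylvester (j + 1)).anti (by omega)).mono ?_
  have h4 : √((2 : ℝ) ^ (j + 1 + 1)) = 2 * √(2 ^ j) := by
    rw [show (2 : ℝ) ^ (j + 1 + 1) = 2 ^ 2 * 2 ^ j by ring, Real.sqrt_mul (by positivity),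
      Real.sqrt_sq (by norm_num)]
  rw [h4, ← mul_assoc]
  norm_num only
  have : (0 : ℝ) < √(2 ^ j) := by positivity
  gcongr

theorem hasFormRatio_linear {k : ℕ} (hk : 5 ≤ k) :
    HasFormRatio k (1 / ((k : ℝ) - 1 / 2)) := by
  -- For `k = m + 1` the triangular ratio suffices when `m ^ 2 - 4 * m - 2 ≥ 0`. This fails at `m =
  -- 4`, so `k = 5` needs the rook graph, where equality holds.
  obtain rfl | hk6 := hk.eq_or_lt
  · exact hasFormRatio_five.mono (by norm_num)
  · obtain ⟨m, rfl⟩ : ∃ m, k = m + 1 := ⟨k - 1, by omega⟩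
    refine (hasFormRatio_triangular (by omega)).mono ?_
    have hm : (5 : ℝ) ≤ m := by exact_mod_cast (by omega : 5 ≤ m)
    push_cast
    rw [div_le_div_iff₀ (by linarith) (by positivity)]
    nlinarith

theorem mainTheorem11 :
    (∀ k : ℕ, 5 ≤ k → k ≤ 15 →
      1 / ((k : ℝ) - 1 / 2) ≤ cPos k ∧ 1 / ((k : ℝ) - 1 / 2) ≤ cNeg (k - 1)) ∧
    (∀ k : ℕ, 16 ≤ k →
      1 / (4 * Real.sqrt ((k : ℝ) - 1)) ≤ cPos k ∧
        1 / (4 * Real.sqrt ((k : ℝ) - 1)) ≤ cNeg (k - 1)) ∧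
    (∀ k : ℕ, 5 ≤ k → ∃ n₀ : ℕ, ∀ n : ℕ, n₀ ≤ n → k ≤ n →
      ∃ G : SimpleGraph (Fin n), G.Connected ∧
        (⌊(n : ℝ) / (k : ℝ)⌋ : ℝ) < graphEigenvalue G k) := by
  refine ⟨fun k hk _ => ?_, fun k hk => ?_, fun k hk => ?_⟩
  · have hk' : (5 : ℝ) ≤ k := by exact_mod_cast hk
    have h0 : 0 ≤ 1 / ((k : ℝ) - 1 / 2) := one_div_nonneg.2 (by linarith)
    exact ⟨(hasFormRatio_linear hk).le_cPos (by omega) h0,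
      (hasFormRatio_linear hk).le_cNeg (by omega) h0⟩
  · have h0 : 0 ≤ 1 / (4 * √((k : ℝ) - 1)) := by positivity
    exact ⟨(hasFormRatio_sqrt (by omega)).le_cPos (by omega) h0,
      (hasFormRatio_sqrt (by omega)).le_cNeg (by omega) h0⟩
  · have hk' : (5 : ℝ) ≤ k := by exact_mod_cast hk
    exact (hasFormRatio_linear hk).exists_connected_floor_lt (by omega)
      (one_div_lt_one_div_of_lt (by linarith) (by linarith))
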